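/- Let $(\Omega,\mathcal F,\mathbb P)$ be a probability space, $n\ge 1$, and let $\mathbf X=(X_1,\dots,X_n)$ be a random vector with $X_1,\dots,X_n\in L^1$. For $X\in L^1$ and $\alpha\in(0,1)$ let $\mathrm{ex}_\alpha(X)$ be the expectile, the unique $t\in\mathbb R$ with $(1-\alpha)\mathbb E[(X-t)_+]=\alpha\,\mathbb E[(X-t)_-]$, where $(x)_+=\max\{x,0\}$ and $(x)_-=\max\{-x,0\}$, and let $$\mathrm{DQ}^{\mathrm{ex}}_\alpha(\mathbf X)=\frac{\alpha^*}{\alpha},\qquad \alpha^*=\inf\Big\{\beta\in(0,1):\ \mathrm{ex}_\beta\Big(\sum_{i=1}^n X_i\Big)\le\sum_{i=1}^n\mathrm{ex}_\alpha(X_i)\Big\},\qquad \inf\varnothing=1.$$ Let $\|\cdot\|$ be the $L_1$-norm on $\mathbb R^n$ and $\mathbb S^{n-1}=\{\mathbf s\in\mathbb R^n:\|\mathbf s\|=1\}$. For $\gamma>0$ and a Borel probability measure $\Psi$ on $\mathbb S^{n-1}$, write $\mathbf X\in\mathrm{MRV}_\gamma(\Psi)$ if for every $t>0$ and every Borel set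 $S\subseteq\mathbb S^{n-1}$ with $\Psi(\partial S)=0$ (boundary relative to $\mathbb S^{n-1}$), $$\lim_{x\to\infty}\frac{\mathbb P(\|\mathbf X\|>tx,\ \mathbf X/\|\mathbf X\|\in S)}{\mathbb P(\|\mathbf X\|>x)}=t^{-\gamma}\,\Psi(S).$$ For a random variable $X$ with distribution function $F_X$, write $X\in\mathrm{RV}_\gamma$ if $\lim_{x\to\infty}\frac{1-F_X(tx)}{1-F_X(x)}=t^{-\gamma}$ for all $t>0$. For $\mathbf x\in\mathbb R^n$ put $\eta_{\mathbf x}=\int_{\mathbb S^{n-1}}(\mathbf x^\top\mathbf s)_+^\gamma\,\Psi(\mathrm d\mathbf s)$; let $\mathbf 1=(1,\dots,1)$ and let $\mathbf e_1,\dots,\mathbf e_n$ be the standard basis vectors. Let $\gamma>1$. (i) If $\mathbf X\in\mathrm{MRV}_\gamma(\Psi)$ and $\sum_{i=1}^n\eta_{\mathbf e_i}^{1/\gamma}>0$, then $$\lim_{\alpha\downarrow0}\mathrm{DQ}^{\mathrm{ex}}_\alpha(\mathbf X)=\eta_{\mathbf 1}\Big(\sum_{i=1}^n\eta_{\mathbf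 e_i}^{1/\gamma}\Big)^{-\gamma}.$$ (ii) If $X_1,\dots,X_n$ are iid with $X_1\in\mathrm{RV}_\gamma$, then $\lim_{\alpha\downarrow0}\mathrm{DQ}^{\mathrm{ex}}_\alpha(\mathbf X)=n^{1-\gamma}$. -/

import Mathlib

open MeasureTheory ProbabilityTheory Filter Topology

/-- `t` solves the first-order condition `(1 - α) E[(X - t)₊] = α E[(X - t)₋]`. -/
def IsExpectile {Ω : Type*} [MeasurableSpace Ω] (P : Measure Ω) (α : ℝ) (X : Ω → ℝ)
    (t : ℝ) : Prop :=
  (1 - α) * ∫ ω, max (X ω - t) 0 ∂P = α * ∫ ω, max (-(X ω - t)) 0 ∂P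

/-- For integrable `X` and `0 < α < 1` the first-order condition has exactly one solution. -/
theorem existsUnique_isExpectile {Ω : Type*} [MeasurableSpace Ω] (P : Measure Ω)
    [IsProbabilityMeasure P] {α : ℝ} (h0 : 0 < α) (h1 : α < 1) {X : Ω → ℝ}
    (hX : Integrable X P) : ∃! t : ℝ, IsExpectile P α X t := by
  let g : ℝ → ℝ := fun t =>
    ∫ ω, ((1 - α) * max (X ω - t) 0 - α * max (-(X ω - t)) 0) ∂P
  have hXt (t : ℝ) : Integrable (fun ω => X ω - t) P := hX.sub (integrable_const t)
  have hp (t : ℝ) : Integrable (fun ω => (1 - α) * max (X ω - t) 0) P :=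
    (hXt t).pos_part.const_mul _
  have hm (t : ℝ) : Integrable (fun ω => α * max (-(X ω - t)) 0) P :=
    (hXt t).neg_part.const_mul _
  have hg (t : ℝ) : IsExpectile P α X t ↔ g t = 0 := by
    have e : g t = (1 - α) * ∫ ω, max (X ω - t) 0 ∂P
        - α * ∫ ω, max (-(X ω - t)) 0 ∂P := by
      simp only [g]
      rw [integral_sub (hp t) (hm t), integral_const_mul, integral_const_mul]
    rw [e, sub_eq_zero]
    rfl
  obtain ⟨m, hm0, hmα, hmα'⟩ : ∃ m : ℝ, 0 < m ∧ m ≤ α ∧ m ≤ 1 - α :=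
    ⟨min α (1 - α), lt_min h0 (by linarith), min_le_left _ _, min_le_right _ _⟩
  have key (s t : ℝ) (hst : s ≤ t) : m * (t - s) ≤ g s - g t ∧ g s - g t ≤ t - s := by
    have e : g s - g t = ∫ ω, (((1 - α) * max (X ω - s) 0 - α * max (-(X ω - s)) 0)
        - ((1 - α) * max (X ω - t) 0 - α * max (-(X ω - t)) 0)) ∂P :=
      (integral_sub ((hp s).sub (hm s)) ((hp t).sub (hm t))).symm
    have hi := ((hp s).sub (hm s)).sub ((hp t).sub (hm t))
    have c (r : ℝ) : ∫ _ω, r ∂P = r := by simp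
    rw [e]
    constructor
    · rw [← c (m * (t - s))]
      refine integral_mono (integrable_const _) hi fun ω => ?_
      rcases max_cases (X ω - s) 0 with ⟨a, _⟩ | ⟨a, _⟩ <;>
      rcases max_cases (X ω - t) 0 with ⟨b, _⟩ | ⟨b, _⟩ <;>
      rcases max_cases (-(X ω - s)) 0 with ⟨c, _⟩ | ⟨c, _⟩ <;>
      rcases max_cases (-(X ω - t)) 0 with ⟨d, _⟩ | ⟨d, _⟩ <;>
      rw [a, b, c, d] <;> nlinarith
    · rw [← c (t - s)]
      refine integral_mono hi (integrable_const _) fun ω => ?_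
      rcases max_cases (X ω - s) 0 with ⟨a, _⟩ | ⟨a, _⟩ <;>
      rcases max_cases (X ω - t) 0 with ⟨b, _⟩ | ⟨b, _⟩ <;>
      rcases max_cases (-(X ω - s)) 0 with ⟨c, _⟩ | ⟨c, _⟩ <;>
      rcases max_cases (-(X ω - t)) 0 with ⟨d, _⟩ | ⟨d, _⟩ <;>
      rw [a, b, c, d] <;> nlinarith
  have hcont : Continuous g := by
    refine (LipschitzWith.of_dist_le_mul (K := 1) fun s t => ?_).continuous
    rw [Real.dist_eq, Real.dist_eq, NNReal.coe_one, one_mul]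
    rcases le_total s t with h | h
    · have := key s t h
      rw [abs_of_nonneg (by nlinarith), abs_of_nonpos (by linarith)]
      linarith
    · have := key t s h
      rw [abs_of_nonpos (by nlinarith), abs_of_nonneg (by linarith)]
      linarith
  have hr : 0 ≤ |g 0| / m := by positivity
  have hrm : m * (|g 0| / m) = |g 0| := by field_simp
  have hlo : g (|g 0| / m) ≤ 0 := by
    have := (key 0 (|g 0| / m) hr).1
    have := le_abs_self (g 0)
    linarith
  have hhi : 0 ≤ g (-(|g 0| / m)) := by
    have := (key (-(|g 0| / m)) 0 (by linarith)).1
    have := neg_abs_le (g 0)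
    linarith
  obtain ⟨t, ht⟩ : ∃ t, g t = 0 :=
    mem_range_of_exists_le_of_exists_ge hcont ⟨_, hlo⟩ ⟨_, hhi⟩
  refine ⟨t, (hg t).2 ht, fun s hs => ?_⟩
  have hs' := (hg s).1 hs
  rcases le_total s t with h | h
  · have := (key s t h).1
    nlinarith
  · have := (key t s h).1
    nlinarith

open Classical in
/-- The expectile `ex_α(X)`: the unique solution of the first-order condition
(and `0` when there is no unique solution, which cannot happen for `X ∈ L¹`, `0 < α < 1`). -/
noncomputable def expectile {Ω : Type*} [MeasurableSpace Ω] (P : Measure Ω) (α : ℝ)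
    (X : Ω → ℝ) : ℝ :=
  if h : ∃! t : ℝ, IsExpectile P α X t then h.choose else 0

theorem isExpectile_expectile {Ω : Type*} [MeasurableSpace Ω] (P : Measure Ω)
    [IsProbabilityMeasure P] {α : ℝ} (h0 : 0 < α) (h1 : α < 1) {X : Ω → ℝ}
    (hX : Integrable X P) : IsExpectile P α X (expectile P α X) := by
  have h := existsUnique_isExpectile P h0 h1 hX
  rw [expectile, dif_pos h]
  exact h.choose_spec.1

/-- The levels `β ∈ (0,1)` with `ex_β(X₁ + ⋯ + Xₙ) ≤ ex_α(X₁) + ⋯ + ex_α(Xₙ)`. -/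
def dqLevels {Ω : Type*} [MeasurableSpace Ω] (P : Measure Ω) {n : ℕ}
    (X : Fin n → Ω → ℝ) (α : ℝ) : Set ℝ :=
  {β | β ∈ Set.Ioo (0 : ℝ) 1 ∧
    expectile P β (fun ω => ∑ i, X i ω) ≤ ∑ i, expectile P α (X i)}

open Classical in
/-- The diversification quotient based on expectiles, `DQ^ex_α(X) = α* / α`, where `α*` is the
infimum of `dqLevels P X α`, with the convention `inf ∅ = 1`. -/
noncomputable def dqEx {Ω : Type*} [MeasurableSpace Ω] (P : Measure Ω) {n : ℕ}
    (X : Fin n → Ω → ℝ) (α : ℝ) : ℝ :=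
  (if (dqLevels P X α).Nonempty then sInf (dqLevels P X α) else 1) / α

/-- The `L₁`-norm on `ℝⁿ`. -/
def l1norm {n : ℕ} (x : Fin n → ℝ) : ℝ := ∑ i, |x i|

/-- The unit sphere of the `L₁`-norm in `ℝⁿ`. -/
def l1Sphere (n : ℕ) : Set (Fin n → ℝ) := {s | l1norm s = 1}

/-- Multivariate regular variation `X ∈ MRV_γ(Ψ)`. Here `Ψ` is a Borel measure on the sphere, and
`frontier S` is the boundary of `S` relative to the sphere. -/
structure IsMRV {Ω : Type*} [MeasurableSpace Ω] (P : Measure Ω) {n : ℕ}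
    (X : Fin n → Ω → ℝ) (γ : ℝ) (Ψ : Measure (l1Sphere n)) : Prop where
  index_pos : 0 < γ
  isProbabilityMeasure : IsProbabilityMeasure Ψ
  tendsto_ratio : ∀ t : ℝ, 0 < t → ∀ S : Set (l1Sphere n), MeasurableSet S →
    Ψ (frontier S) = 0 →
    Tendsto (fun x : ℝ =>
      P.real {ω | t * x < l1norm (fun i => X i ω) ∧
          (fun i => X i ω / l1norm (fun j => X j ω)) ∈ ((↑) : l1Sphere n → Fin n → ℝ) '' S} /
        P.real {ω | x < l1norm (fun i => X i ω)})
      atTop (𝓝 (t ^ (-γ) * Ψ.real S))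

/-- Univariate regular variation `X ∈ RV_γ`:
`(1 - F_X(t x)) / (1 - F_X(x)) → t^(-γ)` as `x → ∞`, for all `t > 0`. -/
def IsRV {Ω : Type*} [MeasurableSpace Ω] (P : Measure Ω) (X : Ω → ℝ) (γ : ℝ) : Prop :=
  ∀ t : ℝ, 0 < t → Tendsto
    (fun x : ℝ => (1 - P.real {ω | X ω ≤ t * x}) / (1 - P.real {ω | X ω ≤ x}))
    atTop (𝓝 (t ^ (-γ)))

/-- `η_x = ∫ ((xᵀ s)₊)^γ Ψ(ds)`. -/
noncomputable def spectralEta {n : ℕ} (γ : ℝ) (Ψ : Measure (l1Sphere n))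
    (x : Fin n → ℝ) : ℝ :=
  ∫ s, (max (∑ i, x i * (s : Fin n → ℝ) i) 0) ^ γ ∂Ψ

section Expectile

variable {Ω : Type*} [MeasurableSpace Ω] {P : Measure Ω} {Y : Ω → ℝ}

/-- The ratio `E[(Y - x)₊] / E|Y - x|`; its value at the `α`-expectile of `Y` is `α`. -/
noncomputable def expectileLevel (P : Measure Ω) (Y : Ω → ℝ) (x : ℝ) : ℝ :=
  (∫ ω, max (Y ω - x) 0 ∂P) / ∫ ω, |Y ω - x| ∂P

theorem integral_abs_sub_eq_add [IsProbabilityMeasure P] (hY : Integrable Y P) (x : ℝ) :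
    ∫ ω, |Y ω - x| ∂P = (∫ ω, max (Y ω - x) 0 ∂P) + ∫ ω, max (-(Y ω - x)) 0 ∂P := by
  have h := hY.sub (integrable_const x)
  refine Eq.trans ?_ (integral_add h.pos_part h.neg_part)
  congr 1 with ω
  rcases le_total 0 (Y ω - x) with h | h
  · rw [abs_of_nonneg h, max_eq_left h, max_eq_right (by linarith), add_zero]
  · rw [abs_of_nonpos h, max_eq_right h, max_eq_left (by linarith), zero_add]

theorem isExpectile_iff_integral_abs [IsProbabilityMeasure P] (hY : Integrable Y P) (α x : ℝ) :
    IsExpectile P α Y x ↔ ∫ ω, max (Y ω - x) 0 ∂P = α * ∫ ω, |Y ω - x| ∂P := by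
  rw [integral_abs_sub_eq_add hY, IsExpectile]
  constructor <;> intro h <;> linarith

theorem antitone_integral_pos_part [IsProbabilityMeasure P] (hY : Integrable Y P) :
    Antitone fun x => ∫ ω, max (Y ω - x) 0 ∂P := fun x y hxy =>
  integral_mono (hY.sub (integrable_const y)).pos_part (hY.sub (integrable_const x)).pos_part
    fun _ => max_le_max (by linarith) le_rfl

theorem monotone_integral_neg_part [IsProbabilityMeasure P] (hY : Integrable Y P) :
    Monotone fun x => ∫ ω, max (-(Y ω - x)) 0 ∂P := fun x y hxy =>
  integral_mono (hY.sub (integrable_const x)).neg_part (hY.sub (integrable_const y)).neg_part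
    fun _ => max_le_max (by linarith) le_rfl

theorem expectile_le_iff [IsProbabilityMeasure P] (hY : Integrable Y P) {α : ℝ} (h0 : 0 < α)
    (h1 : α < 1) (y : ℝ) :
    expectile P α Y ≤ y ↔ ∫ ω, max (Y ω - y) 0 ∂P ≤ α * ∫ ω, |Y ω - y| ∂P := by
  have he := isExpectile_expectile P h0 h1 hY
  have key : ∀ z, ∫ ω, max (Y ω - z) 0 ∂P ≤ α * ∫ ω, |Y ω - z| ∂P ↔
      (1 - α) * ∫ ω, max (Y ω - z) 0 ∂P ≤ α * ∫ ω, max (-(Y ω - z)) 0 ∂P := fun z => by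
    rw [integral_abs_sub_eq_add hY]
    constructor <;> intro h <;> linarith
  rw [key]
  have mono : ∀ {u v : ℝ}, u ≤ v →
      (1 - α) * ∫ ω, max (Y ω - v) 0 ∂P ≤ (1 - α) * ∫ ω, max (Y ω - u) 0 ∂P ∧
      α * ∫ ω, max (-(Y ω - u)) 0 ∂P ≤ α * ∫ ω, max (-(Y ω - v)) 0 ∂P := fun h =>
    ⟨mul_le_mul_of_nonneg_left (antitone_integral_pos_part hY h) (by linarith),
      mul_le_mul_of_nonneg_left (monotone_integral_neg_part hY h) h0.le⟩
  rw [IsExpectile] at he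
  constructor
  · intro h
    linarith [(mono h).1, (mono h).2]
  · intro h
    by_contra! hlt
    have hy : IsExpectile P α Y y := by
      rw [IsExpectile]
      linarith [(mono hlt.le).1, (mono hlt.le).2]
    exact hlt.ne ((existsUnique_isExpectile P h0 h1 hY).unique hy he)

theorem expectileLevel_expectile [IsProbabilityMeasure P] (hY : Integrable Y P) {α : ℝ}
    (h0 : 0 < α) (h1 : α < 1) (hpos : 0 < ∫ ω, |Y ω - expectile P α Y| ∂P) :
    expectileLevel P Y (expectile P α Y) = α := by
  have h := (isExpectile_iff_integral_abs hY α _).1 (isExpectile_expectile P h0 h1 hY)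
  rw [expectileLevel, h, mul_div_assoc, div_self hpos.ne', mul_one]

theorem expectile_le_iff_expectileLevel_le [IsProbabilityMeasure P] (hY : Integrable Y P) {α : ℝ}
    (h0 : 0 < α) (h1 : α < 1) {y : ℝ} (hpos : 0 < ∫ ω, |Y ω - y| ∂P) :
    expectile P α Y ≤ y ↔ expectileLevel P Y y ≤ α := by
  rw [expectile_le_iff hY h0 h1, expectileLevel, div_le_iff₀ hpos]

theorem expectileLevel_nonneg (x : ℝ) : 0 ≤ expectileLevel P Y x :=
  div_nonneg (integral_nonneg fun _ => le_max_right _ _) (integral_nonneg fun _ => abs_nonneg _)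

theorem expectile_antitoneOn [IsProbabilityMeasure P] (hY : Integrable Y P) {α β : ℝ}
    (h0 : 0 < α) (hαβ : α ≤ β) (h1 : β < 1) : expectile P β Y ≤ expectile P α Y := by
  rw [expectile_le_iff hY (h0.trans_le hαβ) h1]
  refine ((expectile_le_iff hY h0 (hαβ.trans_lt h1) _).1 le_rfl).trans ?_
  exact mul_le_mul_of_nonneg_right hαβ (integral_nonneg fun _ => abs_nonneg _)

theorem dqEx_eq_expectileLevel_div [IsProbabilityMeasure P] {n : ℕ} {X : Fin n → Ω → ℝ}
    (hX : ∀ i, Integrable (X i) P) {α y : ℝ} (hy : y = ∑ i, expectile P α (X i))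
    (hpos : 0 < ∫ ω, |(∑ i, X i ω) - y| ∂P)
    (hlt : expectileLevel P (fun ω => ∑ i, X i ω) y < 1) :
    dqEx P X α = expectileLevel P (fun ω => ∑ i, X i ω) y / α := by
  have hS : Integrable (fun ω => ∑ i, X i ω) P := integrable_finsetSum _ fun i _ => hX i
  set φ := expectileLevel P (fun ω => ∑ i, X i ω) y with hφ
  have hmem : ∀ β, β ∈ dqLevels P X α ↔ β ∈ Set.Ioo 0 1 ∧ φ ≤ β := fun β => by
    rw [dqLevels, Set.mem_ofPred_eq, ← hy]
    exact and_congr_right fun h => expectile_le_iff_expectileLevel_le hS h.1 h.2 hpos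
  have hφ0 : 0 ≤ φ := expectileLevel_nonneg y
  have hmem' : ∀ β, φ < β → β < 1 → β ∈ dqLevels P X α := fun β h h' =>
    (hmem β).2 ⟨⟨hφ0.trans_lt h, h'⟩, h.le⟩
  have hne : (dqLevels P X α).Nonempty := by
    obtain ⟨β, h, h'⟩ := exists_between hlt
    exact ⟨β, hmem' β h h'⟩
  have hbdd : BddBelow (dqLevels P X α) := ⟨φ, fun β h => ((hmem β).1 h).2⟩
  rw [dqEx, if_pos hne]
  congr 1
  refine le_antisymm (le_of_forall_gt_imp_ge_of_dense fun β h => ?_)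
    (le_csInf hne fun β h => ((hmem β).1 h).2)
  obtain ⟨β', h1, h2⟩ := exists_between (lt_min h hlt)
  exact (csInf_le hbdd (hmem' β' h1 (h2.trans_le (min_le_right _ _)))).trans
    (h2.le.trans (min_le_left _ _))

/-- The mean absolute deviation from `x` is asymptotically equivalent to `x`. -/
theorem tendsto_integral_abs_sub_div [IsProbabilityMeasure P] (hY : Integrable Y P) :
    Tendsto (fun x => (∫ ω, |Y ω - x| ∂P) / x) atTop (𝓝 1) := by
  have h0 : Tendsto (fun x : ℝ => (∫ ω, |Y ω| ∂P) / x) atTop (𝓝 0) :=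
    tendsto_const_nhds.div_atTop tendsto_id
  have c (r : ℝ) : ∫ _ω, r ∂P = r := by simp
  have hlo : Tendsto (fun x : ℝ => 1 - (∫ ω, |Y ω| ∂P) / x) atTop (𝓝 1) := by
    simpa using tendsto_const_nhds.sub h0
  have hhi : Tendsto (fun x : ℝ => 1 + (∫ ω, |Y ω| ∂P) / x) atTop (𝓝 1) := by
    simpa using tendsto_const_nhds.add h0
  refine tendsto_of_tendsto_of_tendsto_of_le_of_le' hlo hhi ?_ ?_ <;>
    filter_upwards [eventually_gt_atTop 0] with x hx
  · rw [le_div_iff₀ hx, sub_mul, div_mul_cancel₀ _ hx.ne', one_mul]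
    nth_rewrite 1 [← c x]
    rw [← integral_sub (integrable_const _) hY.abs]
    refine integral_mono ((integrable_const _).sub hY.abs)
      (hY.sub (integrable_const x)).abs fun ω => ?_
    have := neg_abs_le (Y ω - x)
    have := le_abs_self (Y ω)
    dsimp only
    linarith
  · rw [div_le_iff₀ hx, add_mul, div_mul_cancel₀ _ hx.ne', one_mul]
    nth_rewrite 2 [← c x]
    rw [← integral_add (integrable_const _) hY.abs]
    refine integral_mono (hY.sub (integrable_const x)).abs
      ((integrable_const _).add hY.abs) fun ω => ?_
    have := abs_sub (Y ω) x
    rw [abs_of_pos hx] at this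
    dsimp only
    linarith

theorem eventually_integral_abs_sub_pos [IsProbabilityMeasure P] (hY : Integrable Y P) :
    ∀ᶠ x in atTop, 0 < ∫ ω, |Y ω - x| ∂P := by
  filter_upwards [(tendsto_integral_abs_sub_div hY).eventually (lt_mem_nhds one_pos),
    eventually_gt_atTop 0] with x h hx
  exact (div_pos_iff_of_pos_right hx).1 h

end Expectile

section RegularVariation

/-- A positive antitone function which is regularly varying at infinity with index `-γ`. -/
structure IsRegVarTail (G : ℝ → ℝ) (γ : ℝ) : Prop where
  antitone : Antitone G
  pos : ∀ x, 0 < G x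
  tendsto_ratio : ∀ t, 0 < t → Tendsto (fun x => G (t * x) / G x) atTop (𝓝 (t ^ (-γ)))

variable {G : ℝ → ℝ} {γ : ℝ}

theorem IsRegVarTail.tendsto_zero (hG : IsRegVarTail G γ) (hγ : 0 < γ) :
    Tendsto G atTop (𝓝 0) := by
  have h := tendsto_atTop_ciInf hG.antitone ⟨0, by rintro _ ⟨x, rfl⟩; exact (hG.pos x).le⟩
  set l := ⨅ i, G i
  by_cases hl : l = 0
  · rwa [hl] at h
  have h2 : Tendsto (fun x => G (2 * x) / G x) atTop (𝓝 (l / l)) :=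
    (h.comp (tendsto_id.const_mul_atTop two_pos)).div h hl
  have := tendsto_nhds_unique h2 (hG.tendsto_ratio 2 two_pos)
  rw [div_self hl] at this
  exact absurd this (Real.rpow_lt_one_of_one_lt_of_neg one_lt_two (neg_neg_of_pos hγ)).ne'

/-- A Potter bound: an upper power bound for the ratio, uniform in the dilation factor. -/
theorem IsRegVarTail.eventually_le_mul_rpow (hG : IsRegVarTail G γ) {p : ℝ} (hp0 : 0 < p)
    (hp : p < γ) :
    ∀ᶠ x in atTop, ∀ v, 1 ≤ v → G (v * x) ≤ 2 ^ p * v ^ (-p) * G x := by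
  have h2 : ∀ᶠ x in atTop, G (2 * x) / G x < 2 ^ (-p) :=
    (hG.tendsto_ratio 2 two_pos).eventually
      (gt_mem_nhds (Real.rpow_lt_rpow_of_exponent_lt one_lt_two (neg_lt_neg hp)))
  obtain ⟨x₀, hx₀⟩ := eventually_atTop.1 h2
  filter_upwards [eventually_ge_atTop x₀, eventually_gt_atTop 0] with x hx hxpos v hv
  have hdouble : ∀ k : ℕ, G (2 ^ k * x) ≤ ((2 : ℝ) ^ k) ^ (-p) * G x := by
    intro k
    induction k with
    | zero => simp
    | succ k ih =>
      have hle : x₀ ≤ 2 ^ k * x := hx.trans (le_mul_of_one_le_left hxpos.le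
        (one_le_pow₀ one_le_two))
      have := (div_lt_iff₀ (hG.pos _)).1 (hx₀ _ hle)
      rw [pow_succ', mul_assoc, Real.mul_rpow two_pos.le (by positivity), mul_assoc]
      exact this.le.trans (mul_le_mul_of_nonneg_left ih (by positivity))
  obtain ⟨k, hk1, hk2⟩ := exists_nat_pow_near hv one_lt_two
  have hv0 : 0 < v := one_pos.trans_le hv
  calc G (v * x) ≤ G (2 ^ k * x) := hG.antitone (mul_le_mul_of_nonneg_right hk1 hxpos.le)
    _ ≤ ((2 : ℝ) ^ k) ^ (-p) * G x := hdouble k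
    _ ≤ 2 ^ p * v ^ (-p) * G x := by
      refine mul_le_mul_of_nonneg_right ?_ (hG.pos x).le
      calc ((2 : ℝ) ^ k) ^ (-p) ≤ (v / 2) ^ (-p) := by
            refine Real.rpow_le_rpow_of_nonpos (by positivity) ?_ (by linarith)
            rw [pow_succ] at hk2
            linarith
        _ = 2 ^ p * v ^ (-p) := by
            rw [Real.div_rpow hv0.le two_pos.le, Real.rpow_neg two_pos.le p, div_inv_eq_mul,
              mul_comm]

variable {Ω : Type*} [MeasurableSpace Ω] {P : Measure Ω} {Y : Ω → ℝ}

theorem IsRegVarTail.tendsto_measure_mul_div (hG : IsRegVarTail G γ) {c : ℝ}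
    (hc : Tendsto (fun x => P.real {ω | x < Y ω} / G x) atTop (𝓝 c)) {t : ℝ} (ht : 0 < t) :
    Tendsto (fun x => P.real {ω | t * x < Y ω} / G x) atTop (𝓝 (c * t ^ (-γ))) := by
  refine ((hc.comp (tendsto_id.const_mul_atTop ht)).mul (hG.tendsto_ratio t ht)).congr fun x => ?_
  have := (hG.pos (t * x)).ne'
  simp only [Function.comp, id]
  field_simp

theorem integral_pos_part_eq_mul_integral_tail [IsProbabilityMeasure P] (hY : Integrable Y P)
    {x : ℝ} (hx : 0 < x) :
    ∫ ω, max (Y ω - x) 0 ∂P = x * ∫ v in Set.Ioi 1, P.real {ω | v * x < Y ω} := by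
  have h1 := (hY.sub (integrable_const x)).pos_part.integral_eq_integral_meas_lt
    (Eventually.of_forall fun _ => le_max_right _ _)
  have h2 : ∫ v in Set.Ioi 1, P.real {ω | v * x < Y ω} =
      x⁻¹ * ∫ u in Set.Ioi x, P.real {ω | u < Y ω} := by
    have := integral_comp_mul_left_Ioi (fun u => P.real {ω | u < Y ω}) 1 hx
    simpa only [one_mul, smul_eq_mul, mul_comm x] using this
  have h3 : ∫ u in Set.Ioi x, P.real {ω | u < Y ω} =
      ∫ t in Set.Ioi 0, P.real {ω | t + x < Y ω} := by
    have := (measurePreserving_add_right volume x).setIntegral_preimage_emb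
      (measurableEmbedding_addRight x) (fun u => P.real {ω | u < Y ω}) (Set.Ioi x)
    rw [← this]
    simp
  rw [h2, h3, mul_inv_cancel_left₀ hx.ne']
  refine h1.trans (setIntegral_congr_fun measurableSet_Ioi fun t ht => ?_)
  have ht : 0 < t := ht
  dsimp only [Pi.sub_apply]
  congr 2 with ω
  rw [lt_max_iff]
  constructor
  · rintro (h | h) <;> linarith
  · intro h
    left
    linarith

/-- Karamata's theorem for the stop-loss transform. -/
theorem IsRegVarTail.tendsto_integral_pos_part_div [IsProbabilityMeasure P]
    (hG : IsRegVarTail G γ) (hγ : 1 < γ) (hY : Integrable Y P) {c : ℝ}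
    (hc : Tendsto (fun x => P.real {ω | x < Y ω} / G x) atTop (𝓝 c)) :
    Tendsto (fun x => (∫ ω, max (Y ω - x) 0 ∂P) / (x * G x)) atTop (𝓝 (c / (γ - 1))) := by
  obtain ⟨p, hp1, hpγ⟩ := exists_between hγ
  have hint : ∫ v in Set.Ioi (1 : ℝ), c * v ^ (-γ) = c / (γ - 1) := by
    rw [integral_const_mul, integral_Ioi_rpow_of_lt (by linarith) one_pos, Real.one_rpow,
      ← neg_div_neg_eq, neg_neg, neg_add, neg_neg, ← sub_eq_add_neg, mul_one_div]
  have hlim : Tendsto (fun x => ∫ v in Set.Ioi (1 : ℝ), P.real {ω | v * x < Y ω} / G x) atTop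
      (𝓝 (c / (γ - 1))) := by
    rw [← hint]
    refine tendsto_integral_filter_of_dominated_convergence
      (fun v => (c + 1) * (2 ^ p * v ^ (-p))) ?_ ?_ ?_ ?_
    · filter_upwards [eventually_gt_atTop 0] with x hx
      refine (Antitone.measurable fun u v huv => ?_).aestronglyMeasurable
      refine div_le_div_of_nonneg_right (measureReal_mono fun ω h => ?_) (hG.pos x).le
      exact (mul_le_mul_of_nonneg_right huv hx.le).trans_lt h
    · obtain ⟨x₀, hx₀⟩ := eventually_atTop.1 (hc.eventually (gt_mem_nhds (lt_add_one c)))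
      filter_upwards [hG.eventually_le_mul_rpow (by linarith) hpγ, eventually_ge_atTop x₀,
        eventually_gt_atTop 0] with x hx hxx₀ hx0
      filter_upwards [ae_restrict_mem measurableSet_Ioi] with v hv
      have hv : 1 < v := hv
      rw [Real.norm_of_nonneg (div_nonneg measureReal_nonneg (hG.pos x).le),
        div_le_iff₀ (hG.pos x), mul_assoc]
      have h1 : P.real {ω | v * x < Y ω} < (c + 1) * G (v * x) :=
        (div_lt_iff₀ (hG.pos _)).1
          (hx₀ _ (hxx₀.trans (le_mul_of_one_le_left hx0.le hv.le)))
      have hc1 : 0 ≤ c + 1 :=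
        (pos_of_mul_pos_left (measureReal_nonneg.trans_lt h1) (hG.pos _).le).le
      exact h1.le.trans (mul_le_mul_of_nonneg_left (hx v hv.le) hc1)
    · exact ((integrableOn_Ioi_rpow_of_lt (by linarith) one_pos).const_mul _).const_mul _
    · filter_upwards [ae_restrict_mem measurableSet_Ioi] with v hv
      exact hG.tendsto_measure_mul_div hc (one_pos.trans hv)
  refine hlim.congr' ?_
  filter_upwards [eventually_gt_atTop 0] with x hx
  rw [integral_pos_part_eq_mul_integral_tail hY hx, mul_div_mul_left _ _ hx.ne', integral_div]

theorem IsRegVarTail.tendsto_expectileLevel_div [IsProbabilityMeasure P]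
    (hG : IsRegVarTail G γ) (hγ : 1 < γ) (hY : Integrable Y P) {c : ℝ}
    (hc : Tendsto (fun x => P.real {ω | x < Y ω} / G x) atTop (𝓝 c)) :
    Tendsto (fun x => expectileLevel P Y x / G x) atTop (𝓝 (c / (γ - 1))) := by
  have h := (hG.tendsto_integral_pos_part_div hγ hY hc).div (tendsto_integral_abs_sub_div hY)
    one_ne_zero
  rw [div_one] at h
  refine h.congr' ?_
  filter_upwards [eventually_gt_atTop 0] with x hx
  rw [expectileLevel, Pi.div_apply]
  have := (hG.pos x).ne'
  field_simp

end RegularVariation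

section Asymptotics

variable {G : ℝ → ℝ} {γ : ℝ}

theorem IsRegVarTail.tendsto_ratio_of_tendsto_div (hG : IsRegVarTail G γ) {ι : Type*}
    {l : Filter ι} {u v : ι → ℝ} {r : ℝ} (hr : 0 < r) (hv : Tendsto v l atTop)
    (huv : Tendsto (fun a => u a / v a) l (𝓝 r)) :
    Tendsto (fun a => G (u a) / G (v a)) l (𝓝 (r ^ (-γ))) := by
  have hcont : ContinuousAt (fun s : ℝ => s ^ (-γ)) r :=
    Real.continuousAt_rpow_const _ _ (Or.inl hr.ne')
  refine tendsto_order.2 ⟨fun a ha => ?_, fun a ha => ?_⟩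
  · obtain ⟨s, hs, hrs⟩ : ∃ s, a < s ^ (-γ) ∧ r < s :=
      (((hcont.eventually (lt_mem_nhds ha)).filter_mono nhdsWithin_le_nhds).and
        (self_mem_nhdsWithin (s := Set.Ioi r))).exists
    filter_upwards [((hG.tendsto_ratio s (hr.trans hrs)).comp hv).eventually (lt_mem_nhds hs),
      huv.eventually (gt_mem_nhds hrs), hv.eventually_gt_atTop 0] with i h1 h2 h3
    exact h1.trans_le (div_le_div_of_nonneg_right
      (hG.antitone ((div_lt_iff₀ h3).1 h2).le) (hG.pos _).le)
  · obtain ⟨s, ⟨hs, hs0⟩, hrs⟩ : ∃ s, (s ^ (-γ) < a ∧ 0 < s) ∧ s < r :=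
      ((((hcont.eventually (gt_mem_nhds ha)).and (lt_mem_nhds hr)).filter_mono
        nhdsWithin_le_nhds).and (self_mem_nhdsWithin (s := Set.Iio r))).exists
    filter_upwards [((hG.tendsto_ratio s hs0).comp hv).eventually (gt_mem_nhds hs),
      huv.eventually (lt_mem_nhds hrs), hv.eventually_gt_atTop 0] with i h1 h2 h3
    exact (div_le_div_of_nonneg_right
      (hG.antitone ((lt_div_iff₀ h3).1 h2).le) (hG.pos _).le).trans_lt h1

variable {Ω : Type*} [MeasurableSpace Ω] {P : Measure Ω} {Y Z : Ω → ℝ}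

theorem IsRegVarTail.tendsto_expectile_atTop [IsProbabilityMeasure P] (hG : IsRegVarTail G γ)
    (hγ : 1 < γ) (hY : Integrable Y P) {c : ℝ} (hc0 : 0 < c)
    (hc : Tendsto (fun x => P.real {ω | x < Y ω} / G x) atTop (𝓝 c)) :
    Tendsto (fun α => expectile P α Y) (𝓝[>] 0) atTop := by
  refine tendsto_atTop.2 fun M => ?_
  have h := (hG.tendsto_expectileLevel_div hγ hY hc).eventually
    (lt_mem_nhds (div_pos hc0 (sub_pos.2 hγ)))
  obtain ⟨x, hx, hxM, hpos⟩ :=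
    (h.and ((eventually_ge_atTop M).and (eventually_integral_abs_sub_pos hY))).exists
  have hx' : 0 < expectileLevel P Y x := (div_pos_iff_of_pos_right (hG.pos x)).1 hx
  filter_upwards [Ioo_mem_nhdsGT (lt_min hx' one_pos)] with α hα
  have hα1 := hα.2.trans_le (min_le_right _ _)
  refine hxM.trans (le_of_lt (not_le.1 fun hle => ?_))
  exact ((expectile_le_iff_expectileLevel_le hY hα.1 hα1 hpos).1 hle).not_gt
    (hα.2.trans_le (min_le_left _ _))

theorem IsRegVarTail.tendsto_div_expectile [IsProbabilityMeasure P] (hG : IsRegVarTail G γ)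
    (hγ : 1 < γ) (hY : Integrable Y P) {c : ℝ} (hc0 : 0 < c)
    (hc : Tendsto (fun x => P.real {ω | x < Y ω} / G x) atTop (𝓝 c)) :
    Tendsto (fun α => α / G (expectile P α Y)) (𝓝[>] 0) (𝓝 (c / (γ - 1))) := by
  have hτ := hG.tendsto_expectile_atTop hγ hY hc0 hc
  refine ((hG.tendsto_expectileLevel_div hγ hY hc).comp hτ).congr' ?_
  filter_upwards [hτ.eventually (eventually_integral_abs_sub_pos hY),
    Ioo_mem_nhdsGT one_pos] with α hα hα1
  rw [Function.comp, expectileLevel_expectile hY hα1.1 hα1.2 hα]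

/-- Small-level expectiles of tail-comparable variables are asymptotically proportional. -/
theorem IsRegVarTail.tendsto_expectile_div_expectile [IsProbabilityMeasure P]
    (hG : IsRegVarTail G γ) (hγ : 1 < γ) (hY : Integrable Y P) (hZ : Integrable Z P) {c d : ℝ}
    (hc0 : 0 < c) (hc : Tendsto (fun x => P.real {ω | x < Y ω} / G x) atTop (𝓝 c))
    (hd0 : 0 ≤ d) (hd : Tendsto (fun x => P.real {ω | x < Z ω} / G x) atTop (𝓝 d)) :
    Tendsto (fun α => expectile P α Z / expectile P α Y) (𝓝[>] 0) (𝓝 ((d / c) ^ (1 / γ))) := by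
  have hγ0 : 0 < γ := one_pos.trans hγ
  have hτ := hG.tendsto_expectile_atTop hγ hY hc0 hc
  have hα := hG.tendsto_div_expectile hγ hY hc0 hc
  have hlev : ∀ s, 0 < s → Tendsto (fun α => expectileLevel P Z (s * expectile P α Y) /
      G (expectile P α Y)) (𝓝[>] 0) (𝓝 (d / (γ - 1) * s ^ (-γ))) := fun s hs => by
    have h1 := (hG.tendsto_expectileLevel_div hγ hZ hd).comp (hτ.const_mul_atTop hs)
    refine (h1.mul ((hG.tendsto_ratio s hs).comp hτ)).congr fun α => ?_
    have := (hG.pos (s * expectile P α Y)).ne'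
    simp only [Function.comp]
    field_simp
  have hr0 : 0 ≤ (d / c) ^ (1 / γ) := by positivity
  have hrpow : ((d / c) ^ (1 / γ)) ^ γ = d / c := by
    rw [← Real.rpow_mul (by positivity), one_div_mul_cancel hγ0.ne', Real.rpow_one]
  refine tendsto_order.2 ⟨fun s hs => ?_, fun s hs => ?_⟩
  · rcases lt_or_ge 0 s with hs0 | hs0
    · have hlt : c / (γ - 1) < d / (γ - 1) * s ^ (-γ) := by
        rw [div_mul_eq_mul_div]
        refine div_lt_div_of_pos_right ?_ (sub_pos.2 hγ)
        rw [Real.rpow_neg hs0.le, ← div_eq_mul_inv, lt_div_iff₀ (by positivity),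
          ← lt_div_iff₀' hc0, ← hrpow]
        exact Real.rpow_lt_rpow hs0.le hs hγ0
      filter_upwards [hα.eventually_lt (hlev s hs0) hlt, hτ.eventually_gt_atTop 0,
        (hτ.const_mul_atTop hs0).eventually (eventually_integral_abs_sub_pos hZ),
        Ioo_mem_nhdsGT one_pos] with α h1 h2 h3 h4
      rw [lt_div_iff₀ h2]
      refine not_le.1 fun hle => ?_
      exact ((expectile_le_iff_expectileLevel_le hZ h4.1 h4.2 h3).1 hle).not_gt
        ((div_lt_div_iff_of_pos_right (hG.pos _)).1 h1)
    · rcases hs0.lt_or_eq with hs0 | rfl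
      · have hbot := hτ.const_mul_atTop_of_neg hs0
        filter_upwards [hbot.eventually_lt_atBot (expectile P (1 / 2) Z),
          hτ.eventually_gt_atTop 0, Ioo_mem_nhdsGT (one_half_pos (α := ℝ))] with α h1 h2 h3
        rw [lt_div_iff₀ h2]
        exact h1.trans_le (expectile_antitoneOn hZ h3.1 h3.2.le (by norm_num))
      · have hd0' : 0 < d := by
          refine hd0.lt_of_ne fun h => ?_
          rw [← h, zero_div, Real.zero_rpow (by positivity)] at hs
          exact lt_irrefl _ hs
        filter_upwards [(hG.tendsto_expectile_atTop hγ hZ hd0' hd).eventually_gt_atTop 0,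
          hτ.eventually_gt_atTop 0] with α h1 h2
        exact div_pos h1 h2
  · have hs0 : 0 < s := hr0.trans_lt hs
    obtain ⟨s', hs', hs's⟩ := exists_between hs
    have hs0' : 0 < s' := hr0.trans_lt hs'
    have hlt : d / (γ - 1) * s' ^ (-γ) < c / (γ - 1) := by
      rw [div_mul_eq_mul_div]
      refine div_lt_div_of_pos_right ?_ (sub_pos.2 hγ)
      rw [Real.rpow_neg hs0'.le, ← div_eq_mul_inv, div_lt_iff₀ (by positivity),
        ← div_lt_iff₀' hc0, ← hrpow]
      exact Real.rpow_lt_rpow hr0 hs' hγ0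
    filter_upwards [(hlev s' hs0').eventually_lt hα hlt, hτ.eventually_gt_atTop 0,
      (hτ.const_mul_atTop hs0').eventually (eventually_integral_abs_sub_pos hZ),
      Ioo_mem_nhdsGT one_pos] with α h1 h2 h3 h4
    refine lt_of_le_of_lt ?_ hs's
    rw [div_le_iff₀ h2, expectile_le_iff_expectileLevel_le hZ h4.1 h4.2 h3]
    exact ((div_lt_div_iff_of_pos_right (hG.pos _)).1 h1).le

/-- The limit of the expectile diversification quotient in terms of the tail constants of the
components and of the sum. -/
theorem IsRegVarTail.tendsto_dqEx [IsProbabilityMeasure P] (hG : IsRegVarTail G γ) (hγ : 1 < γ)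
    {n : ℕ} {X : Fin n → Ω → ℝ} (hX : ∀ i, Integrable (X i) P) {c : Fin n → ℝ} {d : ℝ}
    (hc : ∀ i, Tendsto (fun x => P.real {ω | x < X i ω} / G x) atTop (𝓝 (c i)))
    (hd : Tendsto (fun x => P.real {ω | x < ∑ i, X i ω} / G x) atTop (𝓝 d))
    (hpos : 0 < ∑ i, c i ^ (1 / γ)) :
    Tendsto (fun α => dqEx P X α) (𝓝[>] 0) (𝓝 (d * (∑ i, c i ^ (1 / γ)) ^ (-γ))) := by
  have hγ0 : 0 < γ := one_pos.trans hγ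
  have hS : Integrable (fun ω => ∑ i, X i ω) P := integrable_finsetSum _ fun i _ => hX i
  have hc0 : ∀ i, 0 ≤ c i := fun i => ge_of_tendsto' (hc i) fun x =>
    div_nonneg measureReal_nonneg (hG.pos x).le
  obtain ⟨j, hj⟩ : ∃ j, 0 < c j := by
    by_contra! h
    refine hpos.ne' (Finset.sum_eq_zero fun i _ => ?_)
    rw [le_antisymm (h i) (hc0 i), Real.zero_rpow (by positivity)]
  set C := ∑ i, c i ^ (1 / γ) with hC
  set τ : ℝ → ℝ := fun α => expectile P α (X j) with hτdef
  set y : ℝ → ℝ := fun α => ∑ i, expectile P α (X i) with hydef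
  have hτ : Tendsto τ (𝓝[>] 0) atTop := hG.tendsto_expectile_atTop hγ (hX j) hj (hc j)
  have hα : Tendsto (fun α => α / G (τ α)) (𝓝[>] 0) (𝓝 (c j / (γ - 1))) :=
    hG.tendsto_div_expectile hγ (hX j) hj (hc j)
  have hcj : 0 < c j ^ (1 / γ) := by positivity
  have hyτ : Tendsto (fun α => y α / τ α) (𝓝[>] 0) (𝓝 (C / c j ^ (1 / γ))) := by
    have h := tendsto_finsetSum Finset.univ fun i _ =>
      hG.tendsto_expectile_div_expectile hγ (hX j) (hX i) hj (hc j) (hc0 i) (hc i)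
    simp only [← Finset.sum_div, Real.div_rpow (hc0 _) hj.le] at h
    exact h
  have hρ : 0 < C / c j ^ (1 / γ) := div_pos hpos hcj
  have hy : Tendsto y (𝓝[>] 0) atTop := by
    refine (hyτ.pos_mul_atTop hρ hτ).congr' ?_
    filter_upwards [hτ.eventually_gt_atTop 0] with α h
    exact div_mul_cancel₀ _ h.ne'
  have hGy := hG.tendsto_ratio_of_tendsto_div hρ hτ hyτ
  have hφ := hG.tendsto_expectileLevel_div hγ hS hd
  have hφ0 : Tendsto (expectileLevel P fun ω => ∑ i, X i ω) atTop (𝓝 0) := by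
    have := hφ.mul (hG.tendsto_zero hγ0)
    rw [mul_zero] at this
    exact this.congr fun x => div_mul_cancel₀ _ (hG.pos x).ne'
  have hγ1 : γ - 1 ≠ 0 := (sub_pos.2 hγ).ne'
  have hlim := ((hφ.comp hy).mul hGy).div hα (div_pos hj (sub_pos.2 hγ)).ne'
  have hval : d / (γ - 1) * (C / c j ^ (1 / γ)) ^ (-γ) / (c j / (γ - 1)) = d * C ^ (-γ) := by
    rw [Real.div_rpow hpos.le hcj.le, ← Real.rpow_mul hj.le, one_div_mul_eq_div,
      neg_div, div_self hγ0.ne', Real.rpow_neg_one]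
    field_simp
  rw [hval] at hlim
  refine hlim.congr' ?_
  filter_upwards [hy.eventually (eventually_integral_abs_sub_pos hS),
    (hφ0.comp hy).eventually (gt_mem_nhds one_pos), self_mem_nhdsWithin] with α h1 h2 h3
  rw [dqEx_eq_expectileLevel_div (y := y α) hX rfl h1 h2]
  have h4 := (hG.pos (y α)).ne'
  have h5 := (hG.pos (τ α)).ne'
  have h6 : α ≠ 0 := ne_of_gt h3
  simp only [Pi.div_apply, Function.comp]
  field_simp

end Asymptotics

section Tails

variable {Ω : Type*} [MeasurableSpace Ω] {P : Measure Ω} {n : ℕ} {X : Fin n → Ω → ℝ} {γ : ℝ}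

theorem Antitone.pos_of_tendsto_self_div {G : ℝ → ℝ} (hG : Antitone G) (h0 : ∀ x, 0 ≤ G x)
    (h : Tendsto (fun x => G x / G x) atTop (𝓝 1)) (x : ℝ) : 0 < G x := by
  obtain ⟨z, hz, hxz⟩ :=
    ((h.eventually (lt_mem_nhds one_pos)).and (eventually_ge_atTop x)).exists
  have : G z ≠ 0 := fun h => by simp [h] at hz
  exact ((h0 z).lt_of_ne' this).trans_le (hG hxz)

theorem antitone_measureReal_lt [IsFiniteMeasure P] (R : Ω → ℝ) :
    Antitone fun x => P.real {ω | x < R ω} := fun _ _ hxy =>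
  measureReal_mono fun _ h => hxy.trans_lt h

theorem sum_mul_le_l1norm {a : Fin n → ℝ} (ha : ∀ i, |a i| ≤ 1) (x : Fin n → ℝ) :
    ∑ i, a i * x i ≤ l1norm x := by
  refine Finset.sum_le_sum fun i _ => (le_abs_self _).trans ?_
  rw [abs_mul]
  exact mul_le_of_le_one_left (abs_nonneg _) (ha i)

theorem div_l1norm_mem_l1Sphere {x : Fin n → ℝ} (hx : 0 < l1norm x) :
    (fun i => x i / l1norm x) ∈ l1Sphere n := by
  change ∑ i, |x i / l1norm x| = 1
  simp_rw [abs_div, abs_of_pos hx, ← Finset.sum_div]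
  exact div_self hx.ne'

theorem mem_image_l1Sphere_iff {x : Fin n → ℝ} (hx : 0 < l1norm x) (S : Set (Fin n → ℝ)) :
    (fun i => x i / l1norm x) ∈ ((↑) : l1Sphere n → Fin n → ℝ) '' ((↑) ⁻¹' S) ↔
      (fun i => x i / l1norm x) ∈ S := by
  rw [Subtype.image_preimage_coe]
  exact ⟨fun h => h.2, fun h => ⟨div_l1norm_mem_l1Sphere hx, h⟩⟩

theorem continuous_sum_mul_l1Sphere (a : Fin n → ℝ) :
    Continuous fun s : l1Sphere n => ∑ i, a i * (s : Fin n → ℝ) i :=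
  continuous_finsetSum _ fun i _ =>
    continuous_const.mul ((continuous_apply i).comp continuous_subtype_val)

theorem IsMRV.isRegVarTail [IsProbabilityMeasure P] {Ψ : Measure (l1Sphere n)}
    (h : IsMRV P X γ Ψ) :
    IsRegVarTail (fun x => P.real {ω | x < l1norm fun i => X i ω}) γ := by
  have := h.isProbabilityMeasure
  have hratio : ∀ t, 0 < t → Tendsto (fun x => P.real {ω | t * x < l1norm fun i => X i ω} /
      P.real {ω | x < l1norm fun i => X i ω}) atTop (𝓝 (t ^ (-γ))) := fun t ht => by
    have h1 := h.tendsto_ratio t ht Set.univ MeasurableSet.univ (by simp)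
    rw [probReal_univ, mul_one] at h1
    refine h1.congr' ?_
    filter_upwards [eventually_gt_atTop 0] with x hx
    congr 2
    ext ω
    refine ⟨fun h => h.1, fun h => ⟨h, ?_⟩⟩
    have := (mem_image_l1Sphere_iff ((mul_pos ht hx).trans h) Set.univ).2 trivial
    simpa using this
  refine ⟨antitone_measureReal_lt _,
    (antitone_measureReal_lt _).pos_of_tendsto_self_div (fun _ => measureReal_nonneg) ?_, hratio⟩
  simpa using hratio 1 one_pos

theorem IsMRV.tendsto_measure_level_div {Ψ : Measure (l1Sphere n)} (h : IsMRV P X γ Ψ)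
    (a : Fin n → ℝ) {b b' t : ℝ} (ht : 0 < t)
    (hb : Ψ {s | ∑ i, a i * (s : Fin n → ℝ) i = b} = 0)
    (hb' : Ψ {s | ∑ i, a i * (s : Fin n → ℝ) i = b'} = 0) :
    Tendsto (fun x => P.real {ω | x / t < l1norm (fun i => X i ω) ∧
        b * l1norm (fun i => X i ω) ≤ ∑ i, a i * X i ω ∧
        ∑ i, a i * X i ω < b' * l1norm (fun i => X i ω)} /
      P.real {ω | x < l1norm fun i => X i ω}) atTop
      (𝓝 (t ^ γ * Ψ.real {s | ∑ i, a i * (s : Fin n → ℝ) i ∈ Set.Ico b b'})) := by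
  have hcont := continuous_sum_mul_l1Sphere a
  have hfr : Ψ (frontier {s | ∑ i, a i * (s : Fin n → ℝ) i ∈ Set.Ico b b'}) = 0 := by
    refine measure_mono_null (hcont.frontier_preimage_subset (Set.Ico b b')) ?_
    refine measure_mono_null (fun s hs => ?_) (measure_union_null hb hb')
    rcases lt_or_ge b b' with hlt | hle
    · simpa [frontier_Ico hlt] using hs
    · simp [Set.Ico_eq_empty_of_le hle] at hs
  have h1 := h.tendsto_ratio t⁻¹ (inv_pos.2 ht) _ (hcont.measurable measurableSet_Ico) hfr
  rw [Real.inv_rpow ht.le, Real.rpow_neg ht.le, inv_inv] at h1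
  refine h1.congr' ?_
  filter_upwards [eventually_gt_atTop 0] with x hx
  congr 2
  ext ω
  rw [inv_mul_eq_div]
  refine and_congr_right fun hω => ?_
  have hR := (div_pos hx ht).trans hω
  refine (mem_image_l1Sphere_iff hR {s | ∑ i, a i * s i ∈ Set.Ico b b'}).trans ?_
  simp only [Set.mem_ofPred_eq, ← mul_div_assoc, ← Finset.sum_div, Set.mem_Ico, le_div_iff₀ hR,
    div_lt_iff₀ hR]

/-- Outside countably many scales, no point of a geometric grid is an atom of `f`. -/
theorem exists_forall_measure_level_eq_zero {α : Type*} [MeasurableSpace α] {μ : Measure α}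
    [SFinite μ] {f : α → ℝ} (hf : Measurable f) {r : ℝ} (hr : 0 < r) {p : ℝ → Prop}
    (hp : ∀ᶠ δ in 𝓝[>] 0, p δ) :
    ∃ δ, 0 < δ ∧ p δ ∧ ∀ k : ℕ, μ {a | f a = δ * r ^ k} = 0 := by
  obtain ⟨ε, hε, hsub⟩ := mem_nhdsGT_iff_exists_Ioo_subset.1 hp
  have hcount : (⋃ k : ℕ, (fun δ : ℝ => δ * r ^ k) ⁻¹' {t | 0 < μ {a | f a = t}}).Countable :=
    Set.countable_iUnion fun k => (Measure.countable_meas_level_set_pos hf).preimage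
      (mul_left_injective₀ (pow_pos hr k).ne')
  obtain ⟨δ, hδ, hδ'⟩ := (hcount.dense_compl ℝ).exists_between hε
  refine ⟨δ, hδ'.1, hsub hδ', fun k => ?_⟩
  by_contra hk
  exact hδ (Set.mem_iUnion.2 ⟨k, pos_iff_ne_zero.2 hk⟩)

theorem pairwiseDisjoint_setOf_mem_Ico {α : Type*} (f : α → ℝ) {u : ℕ → ℝ} (hu : Monotone u)
    (s : Set ℕ) : s.PairwiseDisjoint fun k => {a | f a ∈ Set.Ico (u k) (u (k + 1))} := by
  intro k _ l _ hkl
  exact (hu.pairwise_disjoint_on_Ico_succ hkl).preimage f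

/-- The moment `∫ (f₊)^γ` of a function bounded by `1` against its geometric discretization. -/
theorem integral_rpow_geometric_bounds {α : Type*} [MeasurableSpace α] {μ : Measure α}
    [IsProbabilityMeasure μ] {f : α → ℝ} (hf : Measurable f) (hf1 : ∀ a, f a ≤ 1) {δ r : ℝ}
    (hγ : 0 < γ) (hδ : 0 < δ) (hr : 1 < r) {m : ℕ} (hm : 1 < δ * r ^ m) :
    ∑ k ∈ Finset.range m,
        (δ * r ^ k) ^ γ * μ.real {a | f a ∈ Set.Ico (δ * r ^ k) (δ * r ^ (k + 1))} ≤
      ∫ a, max (f a) 0 ^ γ ∂μ ∧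
    ∫ a, max (f a) 0 ^ γ ∂μ ≤ δ ^ γ + ∑ k ∈ Finset.range m,
        (δ * r ^ (k + 1)) ^ γ * μ.real {a | f a ∈ Set.Ico (δ * r ^ k) (δ * r ^ (k + 1))} := by
  have hr0 : 0 < r := one_pos.trans hr
  set u : ℕ → ℝ := fun k => δ * r ^ k with hu
  have hu0 : ∀ k, 0 < u k := fun k => mul_pos hδ (pow_pos hr0 k)
  have humono : Monotone u := fun k l hkl =>
    mul_le_mul_of_nonneg_left (pow_le_pow_right₀ hr.le hkl) hδ.le
  set B : ℕ → Set α := fun k => {a | f a ∈ Set.Ico (u k) (u (k + 1))} with hB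
  have hBm : ∀ k, MeasurableSet (B k) := fun k => hf measurableSet_Ico
  set g : α → ℝ := fun a => max (f a) 0 ^ γ with hg
  have hg0 : ∀ a, 0 ≤ g a := fun a => Real.rpow_nonneg (le_max_right _ _) _
  have hgint : Integrable g μ := by
    refine Integrable.of_bound ((hf.max measurable_const).pow_const γ).aestronglyMeasurable 1
      (Eventually.of_forall fun a => ?_)
    rw [Real.norm_of_nonneg (hg0 a)]
    exact Real.rpow_le_one (le_max_right _ _) (max_le (hf1 a) zero_le_one) hγ.le
  have hsum : ∫ a in ⋃ k ∈ Finset.range m, B k, g a ∂μ =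
      ∑ k ∈ Finset.range m, ∫ a in B k, g a ∂μ :=
    integral_biUnion_finset _ (fun k _ => hBm k) (pairwiseDisjoint_setOf_mem_Ico f humono _)
      fun k _ => hgint.integrableOn
  have hUm : MeasurableSet (⋃ k ∈ Finset.range m, B k) :=
    Finset.measurableSet_biUnion _ fun k _ => hBm k
  have hc : ∀ k (r : ℝ), ∫ _a in B k, r ∂μ = r * μ.real (B k) := fun k r => by
    rw [setIntegral_const, smul_eq_mul, mul_comm]
  constructor
  · calc ∑ k ∈ Finset.range m, u k ^ γ * μ.real (B k)
        ≤ ∑ k ∈ Finset.range m, ∫ a in B k, g a ∂μ := by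
          refine Finset.sum_le_sum fun k _ => ?_
          rw [← hc]
          refine setIntegral_mono_on integrableOn_const hgint.integrableOn (hBm k) fun a ha => ?_
          exact Real.rpow_le_rpow (hu0 k).le (ha.1.trans (le_max_left _ _)) hγ.le
      _ ≤ ∫ a, g a ∂μ := by
          rw [← hsum]
          exact setIntegral_le_integral hgint (Eventually.of_forall hg0)
  · rw [← integral_add_compl hUm hgint, hsum, add_comm]
    refine add_le_add ?_ (Finset.sum_le_sum fun k _ => ?_)
    · calc ∫ a in (⋃ k ∈ Finset.range m, B k)ᶜ, g a ∂μ
          ≤ ∫ _a in (⋃ k ∈ Finset.range m, B k)ᶜ, δ ^ γ ∂μ := by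
            refine setIntegral_mono_on hgint.integrableOn integrableOn_const hUm.compl
              fun a ha => Real.rpow_le_rpow (le_max_right _ _) (max_le ?_ hδ.le) hγ.le
            by_contra! hlt
            obtain ⟨k, hk1, hk2⟩ := exists_nat_pow_near ((one_le_div hδ).2 hlt.le) hr
            rw [le_div_iff₀' hδ] at hk1
            rw [div_lt_iff₀' hδ] at hk2
            have hkm : k < m := by
              have := (hk1.trans (hf1 a)).trans_lt hm
              exact (pow_lt_pow_iff_right₀ hr).1 (lt_of_mul_lt_mul_left this hδ.le)
            exact ha (Set.mem_biUnion (Finset.mem_coe.2 (Finset.mem_range.2 hkm)) ⟨hk1, hk2⟩)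
        _ ≤ δ ^ γ := by
            rw [setIntegral_const, smul_eq_mul]
            exact mul_le_of_le_one_left (Real.rpow_nonneg hδ.le _) measureReal_le_one
    · rw [← hc]
      refine setIntegral_mono_on hgint.integrableOn integrableOn_const (hBm k) fun a ha => ?_
      exact Real.rpow_le_rpow (le_max_right _ _) (max_le ha.2.le (hu0 _).le) hγ.le

/-- Tails of linear combinations of a multivariate regularly varying vector. -/
theorem IsMRV.tendsto_measure_sum_mul_div [IsProbabilityMeasure P] {Ψ : Measure (l1Sphere n)}
    (h : IsMRV P X γ Ψ) (hX : ∀ i, AEMeasurable (X i) P) {a : Fin n → ℝ}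
    (ha : ∀ i, |a i| ≤ 1) :
    Tendsto (fun x => P.real {ω | x < ∑ i, a i * X i ω} /
      P.real {ω | x < l1norm fun i => X i ω}) atTop (𝓝 (spectralEta γ Ψ a)) := by
  have := h.isProbabilityMeasure
  have hγ := h.index_pos
  have hG := h.isRegVarTail
  set R : Ω → ℝ := fun ω => l1norm fun i => X i ω with hRdef
  set Z : Ω → ℝ := fun ω => ∑ i, a i * X i ω with hZdef
  set G : ℝ → ℝ := fun x => P.real {ω | x < R ω} with hGdef
  set f : l1Sphere n → ℝ := fun s => ∑ i, a i * (s : Fin n → ℝ) i with hfdef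
  set η := spectralEta γ Ψ a with hη
  have hRm : AEMeasurable R P := Finset.aemeasurable_fun_sum _ fun i _ => (hX i).norm
  have hZm : AEMeasurable Z P := Finset.aemeasurable_fun_sum _ fun i _ => (hX i).const_mul _
  have hZR : ∀ ω, Z ω ≤ R ω := fun ω => sum_mul_le_l1norm ha _
  have hfm : Measurable f := (continuous_sum_mul_l1Sphere a).measurable
  have hf1 : ∀ s, f s ≤ 1 := fun s => (sum_mul_le_l1norm ha _).trans_eq s.2
  have hRZ : ∀ x, 0 < x → ∀ ω, x < Z ω → 0 < R ω := fun x hx ω hω =>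
    hx.trans (hω.trans_le (hZR ω))
  let E : ℝ → ℝ → ℝ → ℝ → Set Ω := fun t b b' x =>
    {ω | x / t < R ω ∧ b * R ω ≤ Z ω ∧ Z ω < b' * R ω}
  have hEm : ∀ t b b' x, NullMeasurableSet (E t b b' x) P := fun t b b' x =>
    (nullMeasurableSet_lt aemeasurable_const hRm).inter
      ((nullMeasurableSet_le (hRm.const_mul b) hZm).inter
        (nullMeasurableSet_lt hZm (hRm.const_mul b')))
  have key : ∀ r, 1 < r → ∀ δ, 0 < δ → (∀ k : ℕ, Ψ {s | f s = δ * r ^ k} = 0) →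
      ∃ lo hi : ℝ, (η - δ ^ γ) / r ^ γ ≤ lo ∧ hi ≤ δ ^ γ + r ^ γ * η ∧
        (∀ c < lo, ∀ᶠ x in atTop, c < P.real {ω | x < Z ω} / G x) ∧
        ∀ c > hi, ∀ᶠ x in atTop, P.real {ω | x < Z ω} / G x < c := by
    intro r hr δ hδ hgood
    have hr0 : 0 < r := one_pos.trans hr
    obtain ⟨m, hm⟩ := pow_unbounded_of_one_lt δ⁻¹ hr
    rw [inv_lt_iff_one_lt_mul₀' hδ] at hm
    set u : ℕ → ℝ := fun k => δ * r ^ k with hu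
    have hu0 : ∀ k, 0 < u k := fun k => mul_pos hδ (pow_pos hr0 k)
    have humono : Monotone u := fun k l hkl =>
      mul_le_mul_of_nonneg_left (pow_le_pow_right₀ hr.le hkl) hδ.le
    set q : ℕ → ℝ := fun k => Ψ.real {s | f s ∈ Set.Ico (u k) (u (k + 1))} with hq
    obtain ⟨hb1, hb2⟩ := integral_rpow_geometric_bounds (μ := Ψ) hfm hf1 hγ hδ hr hm
    change ∑ k ∈ Finset.range m, u k ^ γ * q k ≤ η at hb1
    change η ≤ δ ^ γ + ∑ k ∈ Finset.range m, u (k + 1) ^ γ * q k at hb2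
    have hscale : ∑ k ∈ Finset.range m, u (k + 1) ^ γ * q k =
        r ^ γ * ∑ k ∈ Finset.range m, u k ^ γ * q k := by
      rw [Finset.mul_sum]
      refine Finset.sum_congr rfl fun k _ => ?_
      have : u (k + 1) = r * u k := by simp only [hu, pow_succ]; ring
      rw [this, Real.mul_rpow hr0.le (hu0 k).le, mul_assoc]
    have hrγ : 0 < r ^ γ := Real.rpow_pos_of_pos hr0 γ
    have hlim : ∀ k t, 0 < t → Tendsto (fun x => P.real (E t (u k) (u (k + 1)) x) / G x) atTop
        (𝓝 (t ^ γ * q k)) := fun k t ht =>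
      h.tendsto_measure_level_div a ht (hgood k) (hgood (k + 1))
    refine ⟨∑ k ∈ Finset.range m, u k ^ γ * q k, δ ^ γ + ∑ k ∈ Finset.range m,
      u (k + 1) ^ γ * q k, ?_, ?_, fun c hc => ?_, fun c hc => ?_⟩
    · rw [div_le_iff₀' hrγ, ← hscale]
      linarith
    · rw [hscale]
      linarith [mul_le_mul_of_nonneg_left hb1 hrγ.le]
    · have hl := tendsto_finsetSum (Finset.range m) fun k _ => hlim k (u k) (hu0 k)
      filter_upwards [hl.eventually (lt_mem_nhds hc), eventually_gt_atTop 0] with x hx hx0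
      refine hx.trans_le ?_
      rw [← Finset.sum_div]
      refine div_le_div_of_nonneg_right ?_ (hG.pos x).le
      rw [← measureReal_biUnion_finset₀ _ fun k _ => hEm _ _ _ _]
      · refine measureReal_mono (Set.iUnion₂_subset fun k _ ω hω => ?_)
        exact ((div_lt_iff₀' (hu0 k)).1 hω.1).trans_le hω.2.1
      · intro k hk l hl hkl
        refine Disjoint.aedisjoint ?_
        rw [Set.disjoint_left]
        intro ω h1 h2
        have hR : 0 < R ω := (div_pos hx0 (hu0 k)).trans h1.1
        have hd := Set.disjoint_left.1 (pairwiseDisjoint_setOf_mem_Ico (fun ω => Z ω / R ω)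
          humono Set.univ (Set.mem_univ k) (Set.mem_univ l) hkl)
        exact hd (a := ω) ⟨(le_div_iff₀ hR).2 h1.2.1, (div_lt_iff₀ hR).2 h1.2.2⟩
          ⟨(le_div_iff₀ hR).2 h2.2.1, (div_lt_iff₀ hR).2 h2.2.2⟩
    · have h0 := hG.tendsto_ratio δ⁻¹ (inv_pos.2 hδ)
      rw [Real.inv_rpow hδ.le, Real.rpow_neg hδ.le, inv_inv] at h0
      have hl := h0.add (tendsto_finsetSum (Finset.range m) fun k _ =>
        hlim k (u (k + 1)) (hu0 (k + 1)))
      filter_upwards [hl.eventually (gt_mem_nhds hc), eventually_gt_atTop 0] with x hx hx0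
      refine lt_of_le_of_lt ?_ hx
      rw [← Finset.sum_div, ← add_div]
      refine div_le_div_of_nonneg_right ?_ (hG.pos x).le
      refine le_trans ?_ (add_le_add_right (measureReal_biUnion_finset_le _ _) _)
      refine le_trans (measureReal_mono fun ω hω => ?_) (measureReal_union_le _ _)
      have hω : x < Z ω := hω
      have hR := hRZ x hx0 ω hω
      rcases lt_or_ge (Z ω / R ω) δ with hlt | hge
      · left
        change δ⁻¹ * x < R ω
        rw [inv_mul_lt_iff₀ hδ]
        exact hω.trans ((div_lt_iff₀ hR).1 hlt)
      · right
        obtain ⟨k, hk1, hk2⟩ := exists_nat_pow_near ((one_le_div hδ).2 hge) hr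
        rw [le_div_iff₀' hδ] at hk1
        rw [div_lt_iff₀' hδ, div_lt_iff₀ hR] at hk2
        have hkm : k < m := by
          have := (hk1.trans ((div_le_one hR).2 (hZR ω))).trans_lt hm
          exact (pow_lt_pow_iff_right₀ hr).1 (lt_of_mul_lt_mul_left this hδ.le)
        refine Set.mem_biUnion (Finset.mem_coe.2 (Finset.mem_range.2 hkm)) ⟨?_, ?_, hk2⟩
        · rw [div_lt_iff₀' (hu0 (k + 1))]
          exact hω.trans hk2
        · exact (le_div_iff₀ hR).1 hk1
  have hrlim : Tendsto (fun r : ℝ => r ^ γ) (𝓝[>] 1) (𝓝 1) := by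
    have : ContinuousAt (fun r : ℝ => r ^ γ) 1 :=
      Real.continuousAt_rpow_const _ _ (Or.inl one_ne_zero)
    simpa using this.tendsto.mono_left nhdsWithin_le_nhds
  have hδlim : Tendsto (fun δ : ℝ => δ ^ γ) (𝓝[>] 0) (𝓝 0) := by
    have : ContinuousAt (fun δ : ℝ => δ ^ γ) 0 :=
      Real.continuousAt_rpow_const _ _ (Or.inr hγ.le)
    simpa [Real.zero_rpow hγ.ne'] using this.tendsto.mono_left nhdsWithin_le_nhds
  refine tendsto_order.2 ⟨fun c hc => ?_, fun c hc => ?_⟩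
  · have h1 : Tendsto (fun r : ℝ => η / r ^ γ) (𝓝[>] 1) (𝓝 η) := by
      have := (tendsto_const_nhds (x := η)).div hrlim one_ne_zero
      rwa [div_one] at this
    obtain ⟨r, hrc, hr⟩ := ((h1.eventually (lt_mem_nhds hc)).and self_mem_nhdsWithin).exists
    have h2 : Tendsto (fun δ : ℝ => (η - δ ^ γ) / r ^ γ) (𝓝[>] 0) (𝓝 (η / r ^ γ)) := by
      simpa using (tendsto_const_nhds.sub hδlim).div_const (r ^ γ)
    obtain ⟨δ, hδ, hδc, hgood⟩ := exists_forall_measure_level_eq_zero (μ := Ψ) hfm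
      (one_pos.trans hr) (h2.eventually (lt_mem_nhds hrc))
    obtain ⟨lo, hi, hlo, -, hlo', -⟩ := key r hr δ hδ hgood
    exact hlo' c (hδc.trans_le hlo)
  · have h1 : Tendsto (fun r : ℝ => r ^ γ * η) (𝓝[>] 1) (𝓝 η) := by
      simpa using hrlim.mul_const η
    obtain ⟨r, hrc, hr⟩ := ((h1.eventually (gt_mem_nhds hc)).and self_mem_nhdsWithin).exists
    have h2 : Tendsto (fun δ : ℝ => δ ^ γ + r ^ γ * η) (𝓝[>] 0) (𝓝 (r ^ γ * η)) := by
      simpa using hδlim.add_const (r ^ γ * η)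
    obtain ⟨δ, hδ, hδc, hgood⟩ := exists_forall_measure_level_eq_zero (μ := Ψ) hfm
      (one_pos.trans hr) (h2.eventually (gt_mem_nhds hrc))
    obtain ⟨lo, hi, -, hhi, -, hhi'⟩ := key r hr δ hδ hgood
    exact hhi' c (hhi.trans_lt hδc)

end Tails

section Independent

variable {Ω : Type*} [MeasurableSpace Ω] {P : Measure Ω} {n : ℕ} {X : Fin n → Ω → ℝ} {γ : ℝ}

theorem one_sub_measureReal_le_eq [IsProbabilityMeasure P] {Y : Ω → ℝ} (hY : AEMeasurable Y P)
    (x : ℝ) : 1 - P.real {ω | Y ω ≤ x} = P.real {ω | x < Y ω} := by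
  rw [← probReal_compl_eq_one_sub₀ (nullMeasurableSet_le hY aemeasurable_const)]
  congr 1 with ω
  simp

theorem IsRV.isRegVarTail [IsProbabilityMeasure P] {Y : Ω → ℝ} (hY : AEMeasurable Y P)
    (h : IsRV P Y γ) : IsRegVarTail (fun x => P.real {ω | x < Y ω}) γ := by
  have hratio : ∀ t, 0 < t → Tendsto (fun x => P.real {ω | t * x < Y ω} / P.real {ω | x < Y ω})
      atTop (𝓝 (t ^ (-γ))) := fun t ht => by
    simpa only [one_sub_measureReal_le_eq hY] using h t ht
  refine ⟨antitone_measureReal_lt _,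
    (antitone_measureReal_lt _).pos_of_tendsto_self_div (fun _ => measureReal_nonneg) ?_, hratio⟩
  simpa using hratio 1 one_pos

/-- If a sum exceeds `x` while no term exceeds `(1 - ε) x`, at least two terms are large. -/
theorem exists_pair_lt_of_lt_sum {a : Fin n → ℝ} {x ε : ℝ} (hn : 0 < n) (hx : 0 ≤ x)
    (hε0 : 0 ≤ ε) (hsum : x < ∑ i, a i) (hle : ∀ i, a i ≤ (1 - ε) * x) :
    ∃ i j, i ≠ j ∧ ε / n * x < a i ∧ ε / n * x < a j := by
  by_contra! hcon
  obtain ⟨i, hi⟩ : ∃ i, ∀ j ≠ i, a j ≤ ε / n * x := by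
    by_cases hex : ∃ i, ε / n * x < a i
    · obtain ⟨i, hi⟩ := hex
      exact ⟨i, fun j hj => hcon i j hj.symm hi⟩
    · push Not at hex
      exact ⟨⟨0, hn⟩, fun j _ => hex j⟩
  have hn' : (0 : ℝ) < n := Nat.cast_pos.2 hn
  have hrest : ∑ j ∈ Finset.univ.erase i, a j ≤ ε * x := by
    refine (Finset.sum_le_card_nsmul _ _ (ε / n * x)
      fun j hj => hi j (Finset.ne_of_mem_erase hj)).trans ?_
    rw [nsmul_eq_mul]
    calc ((Finset.univ.erase i).card : ℝ) * (ε / n * x) ≤ n * (ε / n * x) := by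
          refine mul_le_mul_of_nonneg_right (Nat.cast_le.2 ?_) (by positivity)
          exact (Finset.card_erase_le).trans (by simp)
      _ = ε * x := by field_simp
  rw [← Finset.add_sum_erase _ _ (Finset.mem_univ i)] at hsum
  linarith [hle i]

theorem lt_sum_of_single_large {a : Fin n → ℝ} {x ε : ℝ} (hx : 0 ≤ x) (hε : 0 ≤ ε) {i : Fin n}
    (hi : (1 + ε) * x < a i) (hj : ∀ j ≠ i, |a j| ≤ ε / n * x) : x < ∑ i, a i := by
  have hn' : (0 : ℝ) < n := Nat.cast_pos.2 (Fin.pos i)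
  have hrest : -(ε * x) ≤ ∑ j ∈ Finset.univ.erase i, a j := by
    have h := Finset.card_nsmul_le_sum (Finset.univ.erase i) a (-(ε / n * x))
      fun j hj' => (abs_le.1 (hj j (Finset.ne_of_mem_erase hj'))).1
    refine le_trans ?_ h
    rw [nsmul_eq_mul, mul_neg, neg_le_neg_iff]
    calc ((Finset.univ.erase i).card : ℝ) * (ε / n * x) ≤ n * (ε / n * x) := by
          refine mul_le_mul_of_nonneg_right (Nat.cast_le.2 ?_) (by positivity)
          exact (Finset.card_erase_le).trans (by simp)
      _ = ε * x := by field_simp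
  rw [← Finset.add_sum_erase _ _ (Finset.mem_univ i)]
  linarith

theorem measureReal_lt_sum_le_of_iid [IsProbabilityMeasure P] {Y : Ω → ℝ} (hn : 0 < n)
    (hind : iIndepFun X P) (hid : ∀ i, IdentDistrib (X i) Y P P) {x ε : ℝ} (hx : 0 ≤ x)
    (hε0 : 0 ≤ ε) :
    P.real {ω | x < ∑ i, X i ω} ≤ n * P.real {ω | (1 - ε) * x < Y ω} +
      n ^ 2 * P.real {ω | ε / n * x < Y ω} ^ 2 := by
  have hlaw : ∀ i t, P.real {ω | t < X i ω} = P.real {ω | t < Y ω} := fun i t =>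
    congrArg ENNReal.toReal ((hid i).measure_mem_eq measurableSet_Ioi)
  let A : Fin n × Fin n → Set Ω := fun p =>
    if p.1 = p.2 then ∅ else {ω | ε / n * x < X p.1 ω} ∩ {ω | ε / n * x < X p.2 ω}
  have hA : ∀ p, P.real (A p) ≤ P.real {ω | ε / n * x < Y ω} ^ 2 := fun p => by
    by_cases hp : p.1 = p.2
    · simp only [A, if_pos hp, measureReal_empty]
      positivity
    · simp only [A, if_neg hp]
      have := (hind.indepFun hp).measure_inter_preimage_eq_mul (Set.Ioi (ε / n * x))
        (Set.Ioi (ε / n * x)) measurableSet_Ioi measurableSet_Ioi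
      have h2 := congrArg ENNReal.toReal this
      rw [ENNReal.toReal_mul] at h2
      refine le_of_eq (h2.trans ?_)
      rw [sq]
      exact congrArg₂ _ (hlaw _ _) (hlaw _ _)
  have hsub : {ω | x < ∑ i, X i ω} ⊆ (⋃ i, {ω | (1 - ε) * x < X i ω}) ∪ ⋃ p, A p := by
    intro ω hω
    by_cases hex : ∃ i, (1 - ε) * x < X i ω
    · exact Or.inl (Set.mem_iUnion.2 hex)
    · push Not at hex
      obtain ⟨i, j, hij, hi, hj⟩ := exists_pair_lt_of_lt_sum hn hx hε0 hω hex
      refine Or.inr (Set.mem_iUnion.2 ⟨(i, j), ?_⟩)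
      simp only [A, if_neg hij]
      exact ⟨hi, hj⟩
  refine (measureReal_mono hsub).trans ((measureReal_union_le _ _).trans (add_le_add ?_ ?_))
  · refine (measureReal_iUnion_fintype_le _).trans (le_of_eq ?_)
    simp [hlaw]
  · refine (measureReal_iUnion_fintype_le _).trans
      ((Finset.sum_le_card_nsmul _ _ _ fun p _ => hA p).trans (le_of_eq ?_))
    simp [sq]

theorem le_measureReal_lt_sum_of_iid [IsProbabilityMeasure P] {Y : Ω → ℝ}
    (hind : iIndepFun X P) (hid : ∀ i, IdentDistrib (X i) Y P P) {x ε : ℝ} (hx : 0 < x)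
    (hε0 : 0 ≤ ε) :
    n * (P.real {ω | (1 + ε) * x < Y ω} * P.real {ω | |Y ω| ≤ ε / n * x} ^ (n - 1)) ≤
      P.real {ω | x < ∑ i, X i ω} := by
  let T : Fin n → Fin n → Set ℝ := fun i j =>
    if j = i then Set.Ioi ((1 + ε) * x) else {z | |z| ≤ ε / n * x}
  have hT : ∀ i j, MeasurableSet (T i j) := fun i j => by
    by_cases h : j = i
    · simp only [T, if_pos h, measurableSet_Ioi]
    · simp only [T, if_neg h]
      exact measurableSet_le measurable_id.abs measurable_const
  let A : Fin n → Set Ω := fun i => ⋂ j ∈ Finset.univ, X j ⁻¹' T i j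
  have hAm : ∀ i, NullMeasurableSet (A i) P := fun i =>
    Finset.nullMeasurableSet_biInter _ fun j _ =>
      (hid j).aemeasurable_fst.nullMeasurable (hT i j)
  have hmem : ∀ {i ω}, ω ∈ A i → (1 + ε) * x < X i ω ∧ ∀ j ≠ i, |X j ω| ≤ ε / n * x := by
    intro i ω h
    have h' : ∀ j, X j ω ∈ T i j := by simpa [A] using h
    refine ⟨by simpa [T] using h' i, fun j hj => by simpa [T, hj] using h' j⟩
  have hA : ∀ i, P.real (A i) =
      P.real {ω | (1 + ε) * x < Y ω} * P.real {ω | |Y ω| ≤ ε / n * x} ^ (n - 1) := fun i => by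
    have h := congrArg ENNReal.toReal
      (hind.measure_inter_preimage_eq_mul Finset.univ fun j _ => hT i j)
    rw [ENNReal.toReal_prod, ← Finset.mul_prod_erase _ _ (Finset.mem_univ i)] at h
    refine h.trans (congrArg₂ _ ?_ ?_)
    · rw [(hid i).measure_mem_eq (hT i i)]
      simp only [T, if_true]
      rfl
    · rw [Finset.prod_congr rfl (g := fun _ => P.real {ω | |Y ω| ≤ ε / n * x}),
        Finset.prod_const, Finset.card_erase_of_mem (Finset.mem_univ i), Finset.card_univ,
        Fintype.card_fin]
      intro j hj
      rw [(hid j).measure_mem_eq (hT i j)]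
      simp only [T, if_neg (Finset.ne_of_mem_erase hj)]
      rfl
  calc n * (P.real {ω | (1 + ε) * x < Y ω} * P.real {ω | |Y ω| ≤ ε / n * x} ^ (n - 1))
      = ∑ i, P.real (A i) := by simp [hA]
    _ = P.real (⋃ i ∈ Finset.univ, A i) := by
        rw [measureReal_biUnion_finset₀ _ fun i _ => hAm i]
        intro i _ j _ hij
        refine Disjoint.aedisjoint ?_
        rw [Set.disjoint_left]
        intro ω h1 h2
        have h3 := (hmem h1).1
        have h4 := (le_abs_self _).trans ((hmem h2).2 i hij)
        have hn1 : (1 : ℝ) ≤ n := Nat.one_le_cast.2 (Fin.pos i)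
        have h5 : ε / n ≤ ε := div_le_self hε0 hn1
        nlinarith
    _ ≤ P.real {ω | x < ∑ i, X i ω} := by
        refine measureReal_mono (Set.iUnion₂_subset fun i _ ω hω => ?_)
        exact lt_sum_of_single_large hx.le hε0 (hmem hω).1 (hmem hω).2

theorem tendsto_measureReal_abs_le [IsProbabilityMeasure P] {Y : Ω → ℝ}
    (hY : AEMeasurable Y P) :
    Tendsto (fun x => P.real {ω | |Y ω| ≤ x}) atTop (𝓝 1) := by
  have h := tendsto_cdf_atTop (P.map fun ω => |Y ω|)
  have := Measure.isProbabilityMeasure_map (μ := P) hY.abs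
  refine h.congr fun x => ?_
  rw [cdf_eq_real, map_measureReal_apply_of_aemeasurable hY.abs measurableSet_Iic]
  rfl

/-- The single-big-jump principle for iid variables with a regularly varying right tail. -/
theorem tendsto_measure_lt_sum_div_of_iid [IsProbabilityMeasure P] {Y : Ω → ℝ} (hn : 0 < n)
    (hind : iIndepFun X P) (hid : ∀ i, IdentDistrib (X i) Y P P) (hγ : 0 < γ)
    (hG : IsRegVarTail (fun x => P.real {ω | x < Y ω}) γ) :
    Tendsto (fun x => P.real {ω | x < ∑ i, X i ω} / P.real {ω | x < Y ω}) atTop (𝓝 n) := by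
  have hY : AEMeasurable Y P := (hid ⟨0, hn⟩).aemeasurable_snd
  have hn' : (0 : ℝ) < n := Nat.cast_pos.2 hn
  have hcont : ContinuousAt (fun s : ℝ => n * s ^ (-γ)) 1 :=
    continuousAt_const.mul (Real.continuousAt_rpow_const _ _ (Or.inl one_ne_zero))
  have hlim : Tendsto (fun s : ℝ => n * s ^ (-γ)) (𝓝 1) (𝓝 n) := by
    simpa using hcont.tendsto
  refine tendsto_order.2 ⟨fun c hc => ?_, fun c hc => ?_⟩
  · have h1 : Tendsto (fun ε : ℝ => 1 + ε) (𝓝[>] 0) (𝓝 1) := by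
      have : Continuous fun ε : ℝ => 1 + ε := by fun_prop
      simpa using (this.tendsto 0).mono_left nhdsWithin_le_nhds
    obtain ⟨ε, hεc, hε⟩ := (((hlim.comp h1).eventually (lt_mem_nhds hc)).and
      (self_mem_nhdsWithin (s := Set.Ioi 0))).exists
    have hε : 0 < ε := hε
    have h2 := ((hG.tendsto_ratio (1 + ε) (by linarith)).mul
      (((tendsto_measureReal_abs_le hY).comp
        (tendsto_id.const_mul_atTop (div_pos hε hn'))).pow (n - 1))).const_mul (n : ℝ)
    rw [one_pow, mul_one] at h2
    filter_upwards [h2.eventually (lt_mem_nhds hεc), eventually_gt_atTop 0] with x hx hx0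
    refine hx.trans_le ?_
    rw [div_mul_eq_mul_div, mul_div_assoc']
    exact div_le_div_of_nonneg_right (le_measureReal_lt_sum_of_iid hind hid hx0 hε.le)
      (hG.pos x).le
  · have h1 : Tendsto (fun ε : ℝ => 1 - ε) (𝓝[>] 0) (𝓝 1) := by
      have : Continuous fun ε : ℝ => 1 - ε := by fun_prop
      simpa using (this.tendsto 0).mono_left nhdsWithin_le_nhds
    obtain ⟨ε, hεc, hε, hε1⟩ := (((hlim.comp h1).eventually (gt_mem_nhds hc)).and
      (Ioo_mem_nhdsGT one_pos)).exists
    have hδ := div_pos hε hn'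
    have h3 := ((hG.tendsto_ratio (ε / n) hδ).mul
      ((hG.tendsto_zero hγ).comp (tendsto_id.const_mul_atTop hδ))).const_mul ((n : ℝ) ^ 2)
    have h2 := ((hG.tendsto_ratio (1 - ε) (by linarith)).const_mul (n : ℝ)).add h3
    rw [mul_zero, mul_zero, add_zero] at h2
    filter_upwards [h2.eventually (gt_mem_nhds hεc), eventually_gt_atTop 0] with x hx hx0
    refine lt_of_le_of_lt ?_ hx
    refine (div_le_div_of_nonneg_right (measureReal_lt_sum_le_of_iid hn hind hid hx0.le
      hε.le) (hG.pos x).le).trans (le_of_eq ?_)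
    simp only [Function.comp, id]
    ring

end Independent

theorem proposition8 {Ω : Type*} [MeasurableSpace Ω] (P : Measure Ω) [IsProbabilityMeasure P]
    (n : ℕ) (hn : 0 < n) (X : Fin n → Ω → ℝ) (hX : ∀ i, Integrable (X i) P)
    (γ : ℝ) (hγ : 1 < γ) :
    (∀ Ψ : Measure (l1Sphere n), IsMRV P X γ Ψ →
      0 < ∑ i, spectralEta γ Ψ (Pi.single i 1) ^ (1 / γ) →
      Tendsto (fun α : ℝ => dqEx P X α) (𝓝[>] 0)
        (𝓝 (spectralEta γ Ψ 1 *
          (∑ i, spectralEta γ Ψ (Pi.single i 1) ^ (1 / γ)) ^ (-γ)))) ∧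
    (iIndepFun X P → (∀ i, IdentDistrib (X i) (X ⟨0, hn⟩) P P) → IsRV P (X ⟨0, hn⟩) γ →
      Tendsto (fun α : ℝ => dqEx P X α) (𝓝[>] 0) (𝓝 ((n : ℝ) ^ (1 - γ)))) := by
  have hXm : ∀ i, AEMeasurable (X i) P := fun i => (hX i).aemeasurable
  refine ⟨fun Ψ hΨ hpos => ?_, fun hind hid hRV => ?_⟩
  · refine hΨ.isRegVarTail.tendsto_dqEx hγ hX (fun i => ?_) ?_ hpos
    · have ha : ∀ j, |(Pi.single i 1 : Fin n → ℝ) j| ≤ 1 := fun j => by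
        rcases eq_or_ne j i with rfl | hj
        · simp
        · simp [hj]
      simpa [Pi.single_apply] using hΨ.tendsto_measure_sum_mul_div hXm ha
    · simpa using hΨ.tendsto_measure_sum_mul_div hXm (a := 1) (by simp)
  · have hG := hRV.isRegVarTail (hXm _)
    have hn' : (0 : ℝ) < n := Nat.cast_pos.2 hn
    have hlim := hG.tendsto_dqEx hγ hX (c := fun _ => 1) (d := n) (fun i => ?_)
      (tendsto_measure_lt_sum_div_of_iid hn hind hid (one_pos.trans hγ) hG) (by simpa using hn)
    · rw [sub_eq_add_neg, Real.rpow_add hn', Real.rpow_one]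
      simpa using hlim
    · refine tendsto_const_nhds.congr fun x => ?_
      have h : P.real {ω | x < X i ω} = P.real {ω | x < X ⟨0, hn⟩ ω} :=
        congrArg ENNReal.toReal ((hid i).measure_mem_eq measurableSet_Ioi)
      rw [h, div_self (hG.pos x).ne']
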